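/- Let $n,p\ge 1$, let $f:\mathbb R^d\times\mathbb R^p\to\mathbb R$, and let $x_1,\dots,x_n\in\mathbb R^d$ be fixed. Let $Y_i=f(x_i;\theta^\star)+Z_i$ with $Z_1,\dots,Z_n$ independent $\mathcal N(0,\sigma^2)$ variables, $\sigma>0$. Put $L(\theta)=\frac1{2n}\sum_{i=1}^n(f(x_i;\theta)-Y_i)^2$, $\mathcal I(\theta)=\mathbb E[\nabla^2L(\theta)]$ and, for $\lambda>0$, $$M_\lambda(\theta)=(\nabla^2L(\theta)+\lambda I)^{-1}\Big(\frac1n\sum_{i=1}^n\nabla_\theta f(x_i;\theta)\nabla_\theta f(x_i;\theta)^{\top}\Big)(\nabla^2L(\theta)+\lambda I)^{-1}.$$ Assume that each $f(x_i;\cdot)$ is twice differentiable at $\theta^\star$ with $\max_i\|\nabla^2_\theta f(x_i;\theta^\star)\|_{\mathrm{op}}\le C$ for a constant $C>0$, and that $\mathcal I(\theta^\star)$ is invertible. Let $$X=\frac1n\sum_{i=1}^n\big(f(x_i;\theta^\star)-Y_i\big)\nabla^2_\theta f(x_i;\theta^\star)=-\frac1n\sum_{i=1}^nZ_i\nabla^2_\theta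 f(x_i;\theta^\star),\qquad \hat\lambda=\sqrt{\frac{2n^2p}{\frac{n^3p}{C\sigma^2}+1}}+\big|\min\{0,\lambda_{\min}(X)\}\big|.$$ Then $\hat\lambda>0$, the matrix $\nabla^2L(\theta^\star)+\hat\lambda I$ is always positive definite, $M_{\hat\lambda}(\theta^\star)$ is integrable, and in the Loewner order $$\mathbb E[M_{\hat\lambda}(\theta^\star)]\preceq\mathcal I(\theta^\star)^{-1}+\frac{\sigma^2}{n}I .$$ Consequently the weighting matrix is asymptotically bounded by the inverse Fisher information, with vanishing regularization: for every $\varepsilon>0$ there is $N$, depending only on $\varepsilon,d,p,C,\sigma$, such that for all $n\ge N$ and all models of size $n$ as above, $\mathbb E[M_{\hat\lambda}(\theta^\star)]\preceq\mathcal I(\theta^\star)^{-1}+\varepsilon I$ and $\mathbb P(\hat\lambda>\varepsilon)\le\varepsilon$. -/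

import Mathlib

open MeasureTheory ProbabilityTheory
open scoped NNReal

namespace NonlinearLS

/-- `ℝ^k` with the Euclidean norm. -/
abbrev Vec (k : ℕ) : Type := EuclideanSpace ℝ (Fin k)

/-- The Hessian matrix `∇² g (θ)`: entry `(i, j)` is the second derivative of `g` at `θ`
in the coordinate directions `i` and `j`. -/
noncomputable def hessian {p : ℕ} (g : Vec p → ℝ) (θ : Vec p) : Matrix (Fin p) (Fin p) ℝ :=
  Matrix.of fun i j =>
    fderiv ℝ (fderiv ℝ g) θ (EuclideanSpace.single i 1) (EuclideanSpace.single j 1)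

/-- `g` is twice differentiable at `θ`: it is differentiable near `θ` and its derivative is
differentiable at `θ`. -/
def TwiceDifferentiableAt {p : ℕ} (g : Vec p → ℝ) (θ : Vec p) : Prop :=
  (∀ᶠ τ in nhds θ, DifferentiableAt ℝ g τ) ∧ DifferentiableAt ℝ (fderiv ℝ g) θ

/-- The operator norm (for the Euclidean norm) of a square matrix. -/
noncomputable def opNorm {p : ℕ} (A : Matrix (Fin p) (Fin p) ℝ) : ℝ :=
  ‖Matrix.toEuclideanCLM (n := Fin p) (𝕜 := ℝ) A‖

/-- The Loewner order `A ⪯ B`. -/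
def LoewnerLE {p : ℕ} (A B : Matrix (Fin p) (Fin p) ℝ) : Prop := (B - A).PosSemidef

/-- The smallest (real) eigenvalue of a matrix. It is used for symmetric matrices of size at
least one, which have a nonempty finite set of real eigenvalues. -/
noncomputable def lambdaMin {p : ℕ} (A : Matrix (Fin p) (Fin p) ℝ) : ℝ :=
  sInf {μ : ℝ | Module.End.HasEigenvalue (Matrix.toLin' A) μ}

/-- Entrywise expectation of a random matrix. -/
noncomputable def matrixMean {Ω : Type*} [MeasurableSpace Ω] (P : Measure Ω) {p : ℕ}
    (A : Ω → Matrix (Fin p) (Fin p) ℝ) : Matrix (Fin p) (Fin p) ℝ :=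
  Matrix.of fun i j => ∫ ω, A ω i j ∂P

/-- A random matrix all of whose entries are integrable. -/
def MatrixIntegrable {Ω : Type*} [MeasurableSpace Ω] (P : Measure Ω) {p : ℕ}
    (A : Ω → Matrix (Fin p) (Fin p) ℝ) : Prop :=
  ∀ i j, Integrable (fun ω => A ω i j) P

section Model

variable {d p n : ℕ} (f : Vec d → Vec p → ℝ) (x : Fin n → Vec d)

/-- The empirical risk `L(θ) = 1/(2n) ∑ᵢ (f(xᵢ; θ) - yᵢ)²`. -/
noncomputable def loss (y : Fin n → ℝ) (θ : Vec p) : ℝ :=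
  1 / (2 * (n : ℝ)) * ∑ i, (f (x i) θ - y i) ^ 2

/-- The matrix `1/n ∑ᵢ ∇f(xᵢ; θ) ∇f(xᵢ; θ)ᵀ`. -/
noncomputable def gradGram (θ : Vec p) : Matrix (Fin p) (Fin p) ℝ :=
  (1 / (n : ℝ)) • ∑ i, Matrix.vecMulVec
    (fun j => gradient (f (x i)) θ j) (fun j => gradient (f (x i)) θ j)

/-- The regularized Hessian `∇²L(θ) + lam I`. -/
noncomputable def regHessian (y : Fin n → ℝ) (lam : ℝ) (θ : Vec p) :
    Matrix (Fin p) (Fin p) ℝ :=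
  hessian (loss f x y) θ + lam • (1 : Matrix (Fin p) (Fin p) ℝ)

/-- The weighting matrix
`M(θ) = (∇²L(θ) + lam I)⁻¹ (1/n ∑ᵢ ∇f(xᵢ; θ) ∇f(xᵢ; θ)ᵀ) (∇²L(θ) + lam I)⁻¹`. -/
noncomputable def weightMatrix (y : Fin n → ℝ) (lam : ℝ) (θ : Vec p) :
    Matrix (Fin p) (Fin p) ℝ :=
  (regHessian f x y lam θ)⁻¹ * gradGram f x θ * (regHessian f x y lam θ)⁻¹

/-- The random responses `Yᵢ = f(xᵢ; θs) + Zᵢ` with ground truth `θs` and noise `Z`. -/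
def responses {Ω : Type*} (θs : Vec p) (Z : Fin n → Ω → ℝ) (ω : Ω) : Fin n → ℝ :=
  fun i => f (x i) θs + Z i ω

/-- The Fisher information matrix `E[∇²L(θ)]` of the nonlinear least-squares model with
responses `Y`. -/
noncomputable def fisherInfo {Ω : Type*} [MeasurableSpace Ω] (P : Measure Ω)
    (Y : Ω → Fin n → ℝ) (θ : Vec p) : Matrix (Fin p) (Fin p) ℝ :=
  matrixMean P fun ω => hessian (loss f x (Y ω)) θ

/-- The noise-Hessian term `1/n ∑ᵢ (f(xᵢ; θ) - yᵢ) ∇²f(xᵢ; θ)` of `∇²L(θ)`. -/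
noncomputable def noiseHessian (y : Fin n → ℝ) (θ : Vec p) : Matrix (Fin p) (Fin p) ℝ :=
  (1 / (n : ℝ)) • ∑ i, (f (x i) θ - y i) • hessian (f (x i)) θ

/-- The data-dependent regularization parameter
`√(2n²p / (n³p / (C σ²) + 1)) + |min {0, λ_min(X)}|`, where `X` is the noise-Hessian term. -/
noncomputable def lambdaHat (C σ : ℝ) (θ : Vec p) (y : Fin n → ℝ) : ℝ :=
  Real.sqrt (2 * (n : ℝ) ^ 2 * p / ((n : ℝ) ^ 3 * p / (C * σ ^ 2) + 1))
    + |min 0 (lambdaMin (noiseHessian f x y θ))|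

/-- The weighting matrix `M(θ)` for the data-dependent regularization parameter `lambdaHat`. -/
noncomputable def tunedWeight (C σ : ℝ) (θ : Vec p) (y : Fin n → ℝ) :
    Matrix (Fin p) (Fin p) ℝ :=
  weightMatrix f x y (lambdaHat f x C σ θ y) θ

/-- The assumptions on a fixed-design regression with inputs `x`, ground truth `θs` and noise `Z`:
the noise variables are independent with law `N(0, σ²)`, each `f(xᵢ; ·)` is twice differentiable
at `θs` with Hessian of operator norm at most `C`, and the Fisher information at `θs` is
invertible. -/
structure IsModel {Ω : Type*} [MeasurableSpace Ω] (P : Measure Ω) (Z : Fin n → Ω → ℝ)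
    (θs : Vec p) (C : ℝ) (σ : ℝ≥0) : Prop where
  indep : iIndepFun Z P
  law : ∀ i, HasLaw (Z i) (gaussianReal 0 (σ ^ 2)) P
  twiceDiff : ∀ i, TwiceDifferentiableAt (f (x i)) θs
  hessian_le : ∀ i, opNorm (hessian (f (x i)) θs) ≤ C
  fisher_isUnit : IsUnit (fisherInfo f x P (responses f x θs Z) θs)

end Model

end NonlinearLS

namespace NonlinearLS

/-! ### Positive semidefinite matrices -/

/-! At the ground truth the Hessian of the loss is `G + X`, with `G` the deterministic Gram matrix
of the gradients and `X` linear in the centred noise (`hessian_loss`). Hence the Fisher information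
is `G`, and its invertibility makes `G` positive definite. The regularization makes `D = X + λ̂ I`
positive definite for every outcome, so the weight is `(G + D)⁻¹ G (G + D)⁻¹` with `D ⪰ 0`. This
lies below `G⁻¹` (`inv_mul_mul_inv_le_inv`), and taking means gives the bound outcome by outcome,
even without the `σ²/n` slack. For the vanishing of `λ̂`, the square root is at most `√(2Cσ²/n)`,
while the entries of `X` have second moment at most `C²σ²/n`; Markov's inequality concludes. -/

theorem isHermitian_sub_smul_one {p : ℕ} {A : Matrix (Fin p) (Fin p) ℝ} (hA : A.IsHermitian)
    (t : ℝ) : (A - t • (1 : Matrix (Fin p) (Fin p) ℝ)).IsHermitian :=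
  hA.sub (by simp [Matrix.IsHermitian])

open scoped Pointwise in
theorem posSemidef_sub_smul_one_iff {p : ℕ} {A : Matrix (Fin p) (Fin p) ℝ} (hA : A.IsHermitian)
    (t : ℝ) : (A - t • (1 : Matrix (Fin p) (Fin p) ℝ)).PosSemidef ↔ ∀ μ ∈ spectrum ℝ A, t ≤ μ := by
  have hB := isHermitian_sub_smul_one hA t
  have hs : spectrum ℝ (A - t • (1 : Matrix (Fin p) (Fin p) ℝ))
      = spectrum ℝ A - {t} := by
    rw [spectrum.sub_singleton_eq, Algebra.algebraMap_eq_smul_one]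
  rw [hB.posSemidef_iff_eigenvalues_nonneg]
  have h1 : (0 ≤ hB.eigenvalues) ↔
      ∀ μ ∈ spectrum ℝ (A - t • (1 : Matrix (Fin p) (Fin p) ℝ)), 0 ≤ μ := by
    rw [hB.spectrum_real_eq_range_eigenvalues]
    simp [Pi.le_def]
  rw [h1, hs]
  simp

/-- `t ≤ λ_min(A)` means `t I ⪯ A`. -/
theorem le_lambdaMin_iff {p : ℕ} (hp : 0 < p) {A : Matrix (Fin p) (Fin p) ℝ}
    (hA : A.IsHermitian) (t : ℝ) :
    t ≤ lambdaMin A ↔ (A - t • (1 : Matrix (Fin p) (Fin p) ℝ)).PosSemidef := by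
  -- For `p = 0` the spectrum is empty and `sInf ∅ = 0`, so the equivalence would fail for `t > 0`.
  have : Nonempty (Fin p) := ⟨⟨0, hp⟩⟩
  have hS : {μ : ℝ | Module.End.HasEigenvalue (Matrix.toLin' A) μ} = spectrum ℝ A := by
    ext μ
    rw [Set.mem_ofPred_eq, Module.End.hasEigenvalue_iff_mem_spectrum, Matrix.spectrum_toLin']
  rw [posSemidef_sub_smul_one_iff hA, lambdaMin, hS, hA.spectrum_real_eq_range_eigenvalues]
  exact le_csInf_iff (Set.finite_range _).bddBelow (Set.range_nonempty _)

theorem posSemidef_iff_sum {p : ℕ} {A : Matrix (Fin p) (Fin p) ℝ} :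
    A.PosSemidef ↔ A.IsHermitian ∧ ∀ v : Fin p → ℝ, 0 ≤ ∑ i, ∑ j, v i * A i j * v j := by
  rw [Matrix.posSemidef_iff_dotProduct_mulVec]
  simp [dotProduct, Matrix.mulVec, Finset.mul_sum, mul_assoc]

theorem isClosed_setOf_posSemidef {p : ℕ} :
    IsClosed {A : Matrix (Fin p) (Fin p) ℝ | A.PosSemidef} := by
  simp only [posSemidef_iff_sum, Set.ofPred_and, Set.ofPred_forall]
  refine IsClosed.inter (isClosed_eq (by fun_prop) (by fun_prop))
    (isClosed_iInter fun v => isClosed_le (by fun_prop) (by fun_prop))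

theorem sum_mul_mul_le {p : ℕ} (A : Matrix (Fin p) (Fin p) ℝ) (v : Fin p → ℝ) :
    -((∑ i, ∑ j, |A i j|) * ∑ k, v k ^ 2) ≤ ∑ i, ∑ j, v i * A i j * v j := by
  rw [Finset.sum_mul, ← Finset.sum_neg_distrib]
  refine Finset.sum_le_sum fun i _ => ?_
  rw [Finset.sum_mul, ← Finset.sum_neg_distrib]
  refine Finset.sum_le_sum fun j _ => ?_
  have hi : v i ^ 2 ≤ ∑ k, v k ^ 2 :=
    Finset.single_le_sum (f := fun k => v k ^ 2) (fun k _ => sq_nonneg _) (Finset.mem_univ i)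
  have hj : v j ^ 2 ≤ ∑ k, v k ^ 2 :=
    Finset.single_le_sum (f := fun k => v k ^ 2) (fun k _ => sq_nonneg _) (Finset.mem_univ j)
  have hij : |v i * v j| ≤ ∑ k, v k ^ 2 := by
    rw [abs_le]
    constructor <;> nlinarith [sq_nonneg (v i + v j), sq_nonneg (v i - v j)]
  have h := mul_le_mul_of_nonneg_left hij (abs_nonneg (A i j))
  rw [← abs_mul] at h
  have h2 := neg_abs_le (A i j * (v i * v j))
  nlinarith

/-- A crude bound, but its right side is controlled by entrywise second moments. -/
theorem neg_sum_abs_le_lambdaMin {p : ℕ} (hp : 0 < p) {A : Matrix (Fin p) (Fin p) ℝ}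
    (hA : A.IsHermitian) : -(∑ i, ∑ j, |A i j|) ≤ lambdaMin A := by
  rw [le_lambdaMin_iff hp hA, posSemidef_iff_sum]
  refine ⟨isHermitian_sub_smul_one hA _, fun v => ?_⟩
  have h := sum_mul_mul_le A v
  have h1 : ∑ i, ∑ j, v i * (A - (-∑ i, ∑ j, |A i j|) • (1 : Matrix (Fin p) (Fin p) ℝ)) i j * v j
      = ∑ i, ∑ j, v i * A i j * v j + (∑ i, ∑ j, |A i j|) * ∑ k, v k ^ 2 := by
    have h2 : ∀ (c : ℝ) (i : Fin p),
        ∑ j, v i * (A - (-c) • (1 : Matrix (Fin p) (Fin p) ℝ)) i j * v j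
          = ∑ j, v i * A i j * v j + c * v i ^ 2 := fun c i => by
      simp [Matrix.one_apply, mul_add, add_mul, Finset.sum_add_distrib]
      ring
    rw [Finset.sum_congr rfl fun i _ => h2 _ i, Finset.sum_add_distrib, Finset.mul_sum]
  rw [h1]
  linarith

/-- The part of `A` below zero is removed by adding `|min {0, λ_min(A)}| I`. -/
theorem posSemidef_add_abs_min_lambdaMin {p : ℕ} (hp : 0 < p) {A : Matrix (Fin p) (Fin p) ℝ}
    (hA : A.IsHermitian) :
    (A + |min 0 (lambdaMin A)| • (1 : Matrix (Fin p) (Fin p) ℝ)).PosSemidef := by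
  have h : min 0 (lambdaMin A) ≤ lambdaMin A := min_le_right _ _
  rw [le_lambdaMin_iff hp hA] at h
  rwa [abs_of_nonpos (min_le_left _ _), neg_smul, ← sub_eq_add_neg]

/-- Testing `A` on `e_i ± e_j` bounds the off-diagonal entries by the diagonal ones, and these are
bounded by those of `B`. This turns a Loewner bound into integrability. -/
theorem abs_apply_le_of_posSemidef {p : ℕ} {A B : Matrix (Fin p) (Fin p) ℝ}
    (hA : A.PosSemidef) (hAB : (B - A).PosSemidef) (i j : Fin p) :
    |A i j| ≤ B i i + B j j := by
  have hB : ∀ k, A k k ≤ B k k := fun k => by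
    have := hAB.diag_nonneg (i := k)
    simpa using this
  have h0 : ∀ k, 0 ≤ A k k := fun k => hA.diag_nonneg
  have hs : A j i = A i j := by simpa using hA.1.apply i j
  have h2 : ∀ s : ℝ, 0 ≤ A i i + s * A i j + s * A j i + s * s * A j j := fun s => by
    have h := hA.dotProduct_mulVec_nonneg (Pi.single i 1 + s • Pi.single j 1)
    simp [Matrix.mulVec_add, Matrix.mulVec_smul, add_dotProduct, dotProduct_add] at h
    linarith
  have h3 := h2 1
  have h4 := h2 (-1)
  rw [hs] at h3 h4
  rw [abs_le]
  constructor <;> linarith [hB i, hB j, h0 i, h0 j]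

section Sandwich

variable {p : ℕ} {G D : Matrix (Fin p) (Fin p) ℝ}

theorem posSemidef_inv_mul_mul_inv (hG : G.PosSemidef) (hD : D.PosSemidef) :
    ((G + D)⁻¹ * G * (G + D)⁻¹).PosSemidef := by
  have h := hG.conjTranspose_mul_mul_same (G + D)⁻¹
  rwa [(hG.add hD).isHermitian.inv.eq] at h

/-- Expanding gives `(G + D) G⁻¹ (G + D) - G = 2D + D G⁻¹ D ⪰ 0`; conjugation by `(G + D)⁻¹` gives
the claim. -/
theorem inv_mul_mul_inv_le_inv (hG : G.PosDef) (hD : D.PosSemidef) :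
    (G⁻¹ - (G + D)⁻¹ * G * (G + D)⁻¹).PosSemidef := by
  have hA : (G + D).PosDef := hG.add_posSemidef hD
  have hGu : IsUnit G.det := (Matrix.isUnit_iff_isUnit_det G).1 hG.isUnit
  have hAu : IsUnit (G + D).det := (Matrix.isUnit_iff_isUnit_det _).1 hA.isUnit
  have h1 : (D + D + D * G⁻¹ * D).PosSemidef := by
    refine (hD.add hD).add ?_
    have h := hG.inv.posSemidef.conjTranspose_mul_mul_same D
    rwa [hD.isHermitian.eq] at h
  have h2 : D + D + D * G⁻¹ * D = (G + D) * G⁻¹ * (G + D) - G := by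
    simp only [add_mul, mul_add, Matrix.mul_nonsing_inv _ hGu, Matrix.mul_assoc,
      Matrix.nonsing_inv_mul _ hGu, Matrix.mul_one, one_mul]
    abel
  have h3 := h1.conjTranspose_mul_mul_same (G + D)⁻¹
  rw [hA.inv.isHermitian.eq, h2] at h3
  convert h3 using 1
  rw [mul_sub, sub_mul]
  congr 1
  rw [Matrix.mul_assoc (G + D), Matrix.nonsing_inv_mul_cancel_left _ _ hAu,
    Matrix.mul_nonsing_inv_cancel_right _ _ hAu]

end Sandwich

/-! ### Measurability -/

/-- The sets `{t ≤ λ_min}` are preimages of the closed positive semidefinite cone. -/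
theorem measurable_lambdaMin_comp {p : ℕ} (hp : 0 < p) {E : Type*} [TopologicalSpace E]
    [MeasurableSpace E] [BorelSpace E] {X : E → Matrix (Fin p) (Fin p) ℝ} (hX : Continuous X)
    (hH : ∀ y, (X y).IsHermitian) : Measurable fun y => lambdaMin (X y) := by
  refine measurable_of_Ici fun t => IsClosed.measurableSet ?_
  have h : (fun y => lambdaMin (X y)) ⁻¹' Set.Ici t
      = (fun y => X y - t • (1 : Matrix (Fin p) (Fin p) ℝ)) ⁻¹' {A | A.PosSemidef} := by
    ext y
    simp [le_lambdaMin_iff hp (hH y)]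
  rw [h]
  exact isClosed_setOf_posSemidef.preimage (by fun_prop)

/-- By Cramer's rule; real inversion is measurable at zero as well, so singular matrices need no
exclusion. -/
theorem measurable_inv_apply {p : ℕ} {E : Type*} [MeasurableSpace E]
    {A : E → Matrix (Fin p) (Fin p) ℝ} (hA : ∀ i j, Measurable fun y => A y i j) (i j : Fin p) :
    Measurable fun y => (A y)⁻¹ i j := by
  have hA' : Measurable fun y => (fun i j => A y i j : Fin p → Fin p → ℝ) :=
    measurable_pi_lambda _ fun i => measurable_pi_lambda _ fun j => hA i j
  have hdet : Continuous fun B : Fin p → Fin p → ℝ => (Matrix.of B).det :=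
    Continuous.matrix_det continuous_id
  have hadj : Continuous fun B : Fin p → Fin p → ℝ => (Matrix.of B).adjugate i j :=
    (Continuous.matrix_adjugate continuous_id).matrix_elem i j
  simp only [Matrix.inv_def, Ring.inverse_eq_inv', Matrix.smul_apply, smul_eq_mul]
  exact (hdet.measurable.comp hA').inv.mul (hadj.measurable.comp hA')

theorem measurable_mul_apply {p : ℕ} {E : Type*} [MeasurableSpace E]
    {A B : E → Matrix (Fin p) (Fin p) ℝ} (hA : ∀ i j, Measurable fun y => A y i j)
    (hB : ∀ i j, Measurable fun y => B y i j) (i j : Fin p) :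
    Measurable fun y => (A y * B y) i j := by
  simp only [Matrix.mul_apply]
  exact Finset.measurable_fun_sum _ fun k _ => (hA i k).mul (hB k j)

/-! ### Means of random matrices in the Loewner order -/

theorem posSemidef_matrixMean {Ω : Type*} [MeasurableSpace Ω] {P : Measure Ω} {p : ℕ}
    {A : Ω → Matrix (Fin p) (Fin p) ℝ} (hA : MatrixIntegrable P A) (h : ∀ ω, (A ω).PosSemidef) :
    (matrixMean P A).PosSemidef := by
  rw [posSemidef_iff_sum]
  refine ⟨?_, fun v => ?_⟩
  · ext i j
    have : ∀ ω, A ω j i = A ω i j := fun ω => by simpa using (h ω).1.apply i j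
    simp [matrixMean, this]
  · have h1 : ∑ i, ∑ j, v i * matrixMean P A i j * v j
        = ∫ ω, ∑ i, ∑ j, v i * A ω i j * v j ∂P := by
      have hint : ∀ i j, Integrable (fun ω => v i * A ω i j * v j) P := fun i j =>
        ((hA i j).const_mul _).mul_const _
      rw [integral_finsetSum _ fun i _ => integrable_finsetSum _ fun j _ => hint i j]
      refine Finset.sum_congr rfl fun i _ => ?_
      rw [integral_finsetSum _ fun j _ => hint i j]
      refine Finset.sum_congr rfl fun j _ => ?_
      rw [integral_mul_const, integral_const_mul]
      rfl
    rw [h1]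
    exact integral_nonneg fun ω => (posSemidef_iff_sum.1 (h ω)).2 v

theorem matrixMean_le_of_forall_le {Ω : Type*} [MeasurableSpace Ω] {P : Measure Ω}
    [IsProbabilityMeasure P] {p : ℕ} {A : Ω → Matrix (Fin p) (Fin p) ℝ}
    {B : Matrix (Fin p) (Fin p) ℝ} (hA : MatrixIntegrable P A)
    (h : ∀ ω, LoewnerLE (A ω) B) : LoewnerLE (matrixMean P A) B := by
  have h1 : B - matrixMean P A = matrixMean P fun ω => B - A ω := by
    ext i j
    simp [matrixMean, integral_sub (integrable_const _) (hA i j)]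
  rw [LoewnerLE, h1]
  exact posSemidef_matrixMean (fun i j => (integrable_const _).sub (hA i j)) h

/-! ### Hessians -/

theorem TwiceDifferentiableAt.isHermitian_hessian {p : ℕ} {g : Vec p → ℝ} {θ : Vec p}
    (hg : TwiceDifferentiableAt g θ) : (hessian g θ).IsHermitian := by
  ext i j
  have h := second_derivative_symmetric_of_eventually (𝕜 := ℝ) (f := g) (f' := fderiv ℝ g) (x := θ)
    (hg.1.mono fun τ hτ => hτ.hasFDerivAt) hg.2.hasFDerivAt
  simp [hessian, h (EuclideanSpace.single j 1)]

theorem gradient_apply {p : ℕ} (g : Vec p → ℝ) (θ : Vec p) (j : Fin p) :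
    gradient g θ j = fderiv ℝ g θ (EuclideanSpace.single j 1) := by
  rw [← toDual_gradient, InnerProductSpace.toDual_apply_apply,
    EuclideanSpace.inner_single_right]
  simp

theorem abs_apply_le_opNorm {p : ℕ} (A : Matrix (Fin p) (Fin p) ℝ) (i j : Fin p) :
    |A i j| ≤ opNorm A := by
  have h1 : (Matrix.toEuclideanCLM (n := Fin p) (𝕜 := ℝ) A (EuclideanSpace.single j 1)) i
      = A i j := by
    simp [Matrix.ofLp_toEuclideanCLM]
  have h2 := (Matrix.toEuclideanCLM (n := Fin p) (𝕜 := ℝ) A).le_opNorm (EuclideanSpace.single j 1)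
  rw [← h1, ← Real.norm_eq_abs]
  refine (PiLp.norm_apply_le _ i).trans (h2.trans ?_)
  simp [opNorm]

section Model

variable {d p n : ℕ} {f : Vec d → Vec p → ℝ} {x : Fin n → Vec d} {θ : Vec p}

theorem hessian_loss (hf : ∀ i, TwiceDifferentiableAt (f (x i)) θ) (y : Fin n → ℝ) :
    hessian (loss f x y) θ = gradGram f x θ + noiseHessian f x y θ := by
  -- The first derivative is needed on a neighbourhood, since it is differentiated again at `θ`.
  have h1 : ∀ᶠ τ in nhds θ, fderiv ℝ (loss f x y) τ
      = (1 / (n : ℝ)) • ∑ i, (f (x i) τ - y i) • fderiv ℝ (f (x i)) τ := by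
    filter_upwards [Filter.eventually_all.2 fun i => (hf i).1] with τ hτ
    have h : HasFDerivAt (loss f x y)
        ((1 / (2 * (n : ℝ))) • ∑ i, (2 * (f (x i) τ - y i) ^ 1) • fderiv ℝ (f (x i)) τ) τ :=
      (HasFDerivAt.fun_sum fun i _ => by
        simpa using ((hτ i).hasFDerivAt.sub_const (y i)).pow 2).const_mul _
    rw [h.fderiv, Finset.smul_sum, Finset.smul_sum]
    refine Finset.sum_congr rfl fun i _ => ?_
    rw [smul_smul, smul_smul]
    congr 1
    ring
  have h2 : HasFDerivAt (fun τ => (1 / (n : ℝ)) • ∑ i, (f (x i) τ - y i) • fderiv ℝ (f (x i)) τ)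
      ((1 / (n : ℝ)) • ∑ i, ((f (x i) θ - y i) • fderiv ℝ (fderiv ℝ (f (x i))) θ
        + (fderiv ℝ (f (x i)) θ).smulRight (fderiv ℝ (f (x i)) θ))) θ :=
    (HasFDerivAt.fun_sum fun i _ =>
      ((hf i).1.self_of_nhds.hasFDerivAt.sub_const (y i)).smul (hf i).2.hasFDerivAt).fun_const_smul _
  ext i j
  rw [hessian, Matrix.of_apply, Filter.EventuallyEq.fderiv_eq h1, h2.fderiv]
  simp only [gradGram, noiseHessian, Matrix.add_apply, Matrix.smul_apply, Matrix.sum_apply,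
    hessian, Matrix.of_apply, Matrix.vecMulVec_apply, gradient_apply, smul_eq_mul]
  simp [Finset.sum_add_distrib, add_comm]

theorem posSemidef_gradGram : (gradGram f x θ).PosSemidef :=
  (Matrix.posSemidef_sum _ fun i _ => by
    simpa using Matrix.posSemidef_vecMulVec_self_star
      (fun j => gradient (f (x i)) θ j)).smul (by positivity)

theorem isHermitian_noiseHessian (hf : ∀ i, TwiceDifferentiableAt (f (x i)) θ) (y : Fin n → ℝ) :
    (noiseHessian f x y θ).IsHermitian := by
  ext i j
  simp only [noiseHessian, Matrix.conjTranspose_apply, Matrix.smul_apply, Matrix.sum_apply,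
    star_trivial]
  congr 1
  refine Finset.sum_congr rfl fun k _ => ?_
  rw [← (hf k).isHermitian_hessian.apply i j, star_trivial]

theorem continuous_noiseHessian : Continuous fun y => noiseHessian f x y θ := by
  unfold noiseHessian
  fun_prop

theorem noiseHessian_responses_apply {Ω : Type*} (Z : Fin n → Ω → ℝ) (ω : Ω) (i j : Fin p) :
    noiseHessian f x (responses f x θ Z ω) θ i j
      = ∑ k, -(1 / (n : ℝ)) * hessian (f (x k)) θ i j * Z k ω := by
  simp only [noiseHessian, responses, Matrix.smul_apply, Matrix.sum_apply, smul_eq_mul,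
    Finset.mul_sum]
  refine Finset.sum_congr rfl fun k _ => ?_
  ring

/-! ### The noise -/

section Noise

variable {Ω : Type*} [MeasurableSpace Ω] {P : Measure Ω} {Z : Fin n → Ω → ℝ} {σ : ℝ≥0}

theorem memLp_two_of_hasLaw_gaussianReal {X : Ω → ℝ} {m : ℝ} {v : ℝ≥0}
    (hX : HasLaw X (gaussianReal m v) P) : MemLp X 2 P := by
  have h := memLp_id_gaussianReal (μ := m) (v := v) 2
  rw [← hX.map_eq] at h
  exact (memLp_map_measure_iff aestronglyMeasurable_id hX.aemeasurable).1 h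

theorem integral_sum_mul_noise [IsProbabilityMeasure P]
    (hZ : ∀ k, HasLaw (Z k) (gaussianReal 0 (σ ^ 2)) P)
    (c : Fin n → ℝ) : ∫ ω, ∑ k, c k * Z k ω ∂P = 0 := by
  rw [integral_finsetSum _ fun k _ =>
    ((memLp_two_of_hasLaw_gaussianReal (hZ k)).integrable one_le_two).const_mul _]
  refine Finset.sum_eq_zero fun k _ => ?_
  rw [integral_const_mul, (hZ k).integral_eq, integral_id_gaussianReal, mul_zero]

theorem memLp_sum_mul_noise (hZ : ∀ k, HasLaw (Z k) (gaussianReal 0 (σ ^ 2)) P)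
    (c : Fin n → ℝ) : MemLp (fun ω => ∑ k, c k * Z k ω) 2 P :=
  memLp_finsetSum _ fun k _ => (memLp_two_of_hasLaw_gaussianReal (hZ k)).const_mul _

/-- The mean is zero, so this is a variance, additive by independence. -/
theorem integral_sq_sum_mul_noise [IsProbabilityMeasure P]
    (hZ : ∀ k, HasLaw (Z k) (gaussianReal 0 (σ ^ 2)) P)
    (hind : iIndepFun Z P) (c : Fin n → ℝ) :
    ∫ ω, (∑ k, c k * Z k ω) ^ 2 ∂P = ∑ k, c k ^ 2 * (σ : ℝ) ^ 2 := by
  have h0 := integral_sum_mul_noise hZ c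
  have h1 := variance_of_integral_eq_zero (memLp_sum_mul_noise hZ c).aemeasurable h0
  rw [← h1]
  have h2 : (fun ω => ∑ k, c k * Z k ω) = ∑ k, fun ω => c k * Z k ω := by
    ext ω
    simp
  rw [h2, IndepFun.variance_sum
    (fun k _ => (memLp_two_of_hasLaw_gaussianReal (hZ k)).const_mul _)]
  · refine Finset.sum_congr rfl fun k _ => ?_
    rw [variance_const_mul, (hZ k).variance_eq, variance_id_gaussianReal]
    simp
  · intro k _ l _ hkl
    exact (hind.indepFun hkl).comp (measurable_const_mul (c k)) (measurable_const_mul (c l))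

end Noise

end Model

/-! ### The tuned weighting matrix -/

section Tuned

variable {d p n : ℕ} {f : Vec d → Vec p → ℝ} {x : Fin n → Vec d} {θ : Vec p} {C σ : ℝ}

theorem sqrt_lambdaHat_pos (hp : 0 < p) (hn : 0 < n) (hC : 0 < C) :
    0 < Real.sqrt (2 * (n : ℝ) ^ 2 * p / ((n : ℝ) ^ 3 * p / (C * σ ^ 2) + 1)) := by
  have hp' : (0 : ℝ) < p := by exact_mod_cast hp
  have hn' : (0 : ℝ) < n := by exact_mod_cast hn
  exact Real.sqrt_pos.2 (by positivity)

theorem lambdaHat_pos (hp : 0 < p) (hn : 0 < n) (hC : 0 < C) (y : Fin n → ℝ) :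
    0 < lambdaHat f x C σ θ y :=
  add_pos_of_pos_of_nonneg (sqrt_lambdaHat_pos hp hn hC) (abs_nonneg _)

/-- The eigenvalue part of `λ̂` makes the noise term semidefinite; the positive square root makes it
definite. -/
theorem posDef_noiseHessian_add_lambdaHat (hp : 0 < p) (hn : 0 < n) (hC : 0 < C)
    (hf : ∀ i, TwiceDifferentiableAt (f (x i)) θ) (y : Fin n → ℝ) :
    (noiseHessian f x y θ
      + lambdaHat f x C σ θ y • (1 : Matrix (Fin p) (Fin p) ℝ)).PosDef := by
  have h := ((Matrix.PosDef.one (n := Fin p) (R := ℝ)).smul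
    (sqrt_lambdaHat_pos (σ := σ) hp hn hC)).add_posSemidef
      (posSemidef_add_abs_min_lambdaMin hp (isHermitian_noiseHessian hf y))
  convert h using 1
  rw [lambdaHat, add_smul]
  abel

theorem regHessian_eq (hf : ∀ i, TwiceDifferentiableAt (f (x i)) θ) (y : Fin n → ℝ) (lam : ℝ) :
    regHessian f x y lam θ = gradGram f x θ
      + (noiseHessian f x y θ + lam • (1 : Matrix (Fin p) (Fin p) ℝ)) := by
  rw [regHessian, hessian_loss hf, add_assoc]

theorem posDef_regHessian_lambdaHat (hp : 0 < p) (hn : 0 < n) (hC : 0 < C)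
    (hf : ∀ i, TwiceDifferentiableAt (f (x i)) θ) (y : Fin n → ℝ) :
    (regHessian f x y (lambdaHat f x C σ θ y) θ).PosDef := by
  rw [regHessian_eq hf]
  exact (posDef_noiseHessian_add_lambdaHat hp hn hC hf y).posSemidef_add posSemidef_gradGram

theorem posSemidef_tunedWeight (hp : 0 < p) (hn : 0 < n) (hC : 0 < C)
    (hf : ∀ i, TwiceDifferentiableAt (f (x i)) θ) (y : Fin n → ℝ) :
    (tunedWeight f x C σ θ y).PosSemidef := by
  rw [tunedWeight, weightMatrix, regHessian_eq hf]
  exact posSemidef_inv_mul_mul_inv posSemidef_gradGram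
    (posDef_noiseHessian_add_lambdaHat hp hn hC hf y).posSemidef

theorem tunedWeight_le_inv (hp : 0 < p) (hn : 0 < n) (hC : 0 < C)
    (hf : ∀ i, TwiceDifferentiableAt (f (x i)) θ) (hG : (gradGram f x θ).PosDef)
    (y : Fin n → ℝ) : LoewnerLE (tunedWeight f x C σ θ y) (gradGram f x θ)⁻¹ := by
  rw [LoewnerLE, tunedWeight, weightMatrix, regHessian_eq hf]
  exact inv_mul_mul_inv_le_inv hG (posDef_noiseHessian_add_lambdaHat hp hn hC hf y).posSemidef

theorem measurable_lambdaHat (hp : 0 < p) (hf : ∀ i, TwiceDifferentiableAt (f (x i)) θ) :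
    Measurable (lambdaHat f x C σ θ) :=
  measurable_const.add (measurable_const.min
    (measurable_lambdaMin_comp hp continuous_noiseHessian (isHermitian_noiseHessian hf))).norm

theorem measurable_tunedWeight_apply (hp : 0 < p)
    (hf : ∀ i, TwiceDifferentiableAt (f (x i)) θ) (i j : Fin p) :
    Measurable fun y => tunedWeight f x C σ θ y i j := by
  have hreg : ∀ i j, Measurable fun y => regHessian f x y (lambdaHat f x C σ θ y) θ i j :=
    fun i j => by
      simp only [regHessian_eq hf, Matrix.add_apply, Matrix.smul_apply, smul_eq_mul]
      have hX : Measurable fun y => noiseHessian f x y θ i j :=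
        (continuous_noiseHessian.matrix_elem i j).measurable
      exact (hX.add ((measurable_lambdaHat hp hf).mul_const _)).const_add _
  have hinv := measurable_inv_apply hreg
  have h := measurable_mul_apply
    (measurable_mul_apply (B := fun _ => gradGram f x θ) hinv fun _ _ => measurable_const) hinv i j
  simpa only [tunedWeight, weightMatrix] using h

/-- Dropping the `+ 1` in the denominator leaves exactly `2Cσ²/n` under the root. -/
theorem sqrt_lambdaHat_le (hp : 0 < p) (hn : 0 < n) (hC : 0 < C) (hσ : 0 < σ) {δ : ℝ}
    (hδ : 0 < δ) (hnδ : 2 * C * σ ^ 2 / δ ^ 2 ≤ n) :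
    Real.sqrt (2 * (n : ℝ) ^ 2 * p / ((n : ℝ) ^ 3 * p / (C * σ ^ 2) + 1)) ≤ δ := by
  have hp' : (0 : ℝ) < p := by exact_mod_cast hp
  have hn' : (0 : ℝ) < n := by exact_mod_cast hn
  refine Real.sqrt_le_iff.2 ⟨hδ.le, ?_⟩
  calc 2 * (n : ℝ) ^ 2 * p / ((n : ℝ) ^ 3 * p / (C * σ ^ 2) + 1)
      ≤ 2 * (n : ℝ) ^ 2 * p / ((n : ℝ) ^ 3 * p / (C * σ ^ 2)) := by
        gcongr
        linarith
    _ = 2 * C * σ ^ 2 / n := by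
        field_simp
    _ ≤ δ ^ 2 := by
        rw [div_le_iff₀ (by positivity)] at hnδ ⊢
        linarith

theorem lambdaHat_le (hp : 0 < p) (hf : ∀ i, TwiceDifferentiableAt (f (x i)) θ)
    (y : Fin n → ℝ) :
    lambdaHat f x C σ θ y
      ≤ Real.sqrt (2 * (n : ℝ) ^ 2 * p / ((n : ℝ) ^ 3 * p / (C * σ ^ 2) + 1))
        + ∑ i, ∑ j, |noiseHessian f x y θ i j| := by
  have h := neg_sum_abs_le_lambdaMin hp (isHermitian_noiseHessian hf y)
  have h0 : 0 ≤ ∑ i, ∑ j, |noiseHessian f x y θ i j| := by positivity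
  refine add_le_add le_rfl ?_
  rw [abs_of_nonpos (min_le_left _ _), neg_le]
  exact le_min (by linarith) h

end Tuned

/-! ### Models -/

namespace IsModel

variable {d p n : ℕ} {f : Vec d → Vec p → ℝ} {x : Fin n → Vec d} {θ : Vec p} {C : ℝ} {σ : ℝ≥0}
  {Ω : Type*} [MeasurableSpace Ω] {P : Measure Ω} {Z : Fin n → Ω → ℝ}

theorem aemeasurable_responses (h : IsModel f x P Z θ C σ) :
    AEMeasurable (responses f x θ Z) P :=
  aemeasurable_pi_lambda _ fun i => (h.law i).aemeasurable.const_add _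

variable [IsProbabilityMeasure P]

theorem fisherInfo_eq (h : IsModel f x P Z θ C σ) :
    fisherInfo f x P (responses f x θ Z) θ = gradGram f x θ := by
  ext i j
  simp only [fisherInfo, matrixMean, Matrix.of_apply, hessian_loss h.twiceDiff, Matrix.add_apply,
    noiseHessian_responses_apply]
  rw [integral_add (integrable_const _) ((memLp_sum_mul_noise h.law _).integrable one_le_two),
    integral_sum_mul_noise h.law]
  simp

theorem posDef_gradGram (h : IsModel f x P Z θ C σ) : (gradGram f x θ).PosDef := by
  have hu := h.fisher_isUnit
  rw [h.fisherInfo_eq] at hu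
  exact posSemidef_gradGram.posDef_iff_isUnit.2 hu

theorem matrixIntegrable_tunedWeight (h : IsModel f x P Z θ C σ) (hp : 0 < p) (hn : 0 < n)
    (hC : 0 < C) :
    MatrixIntegrable P fun ω => tunedWeight f x C σ θ (responses f x θ Z ω) := fun i j =>
  Integrable.of_bound ((measurable_tunedWeight_apply hp h.twiceDiff i j).comp_aemeasurable
      h.aemeasurable_responses).aestronglyMeasurable _
    (.of_forall fun _ => abs_apply_le_of_posSemidef
      (posSemidef_tunedWeight hp hn hC h.twiceDiff _)
      (tunedWeight_le_inv hp hn hC h.twiceDiff h.posDef_gradGram _) i j)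

/-- The case `r = 0` is the real content; `r` serves as both `σ²/n` and `ε`. -/
theorem matrixMean_tunedWeight_le (h : IsModel f x P Z θ C σ) (hp : 0 < p) (hn : 0 < n)
    (hC : 0 < C) {r : ℝ} (hr : 0 ≤ r) :
    LoewnerLE (matrixMean P fun ω => tunedWeight f x C σ θ (responses f x θ Z ω))
      ((fisherInfo f x P (responses f x θ Z) θ)⁻¹ + r • (1 : Matrix (Fin p) (Fin p) ℝ)) := by
  have h1 := matrixMean_le_of_forall_le (h.matrixIntegrable_tunedWeight hp hn hC) fun ω =>
    tunedWeight_le_inv hp hn hC h.twiceDiff h.posDef_gradGram (responses f x θ Z ω)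
  rw [h.fisherInfo_eq, LoewnerLE, add_sub_right_comm]
  exact h1.add (Matrix.PosSemidef.one.smul hr)

theorem integral_noiseHessian_sq_le (h : IsModel f x P Z θ C σ) (hn : 0 < n) (i j : Fin p) :
    ∫ ω, noiseHessian f x (responses f x θ Z ω) θ i j ^ 2 ∂P ≤ C ^ 2 * σ ^ 2 / n := by
  have hn' : (0 : ℝ) < n := by exact_mod_cast hn
  simp only [noiseHessian_responses_apply]
  rw [integral_sq_sum_mul_noise h.law h.indep]
  have hk : ∀ k : Fin n, (-(1 / (n : ℝ)) * hessian (f (x k)) θ i j) ^ 2 * (σ : ℝ) ^ 2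
      ≤ (1 / (n : ℝ)) ^ 2 * C ^ 2 * σ ^ 2 := fun k => by
    rw [mul_pow, neg_sq]
    have := sq_le_sq' (abs_le.1 ((abs_apply_le_opNorm _ i j).trans (h.hessian_le k))).1
      (abs_le.1 ((abs_apply_le_opNorm _ i j).trans (h.hessian_le k))).2
    gcongr
  refine (Finset.sum_le_sum fun k _ => hk k).trans_eq ?_
  rw [Finset.sum_const, Finset.card_univ, Fintype.card_fin, nsmul_eq_mul]
  field_simp

/-- The budget `ε` is halved: `h1` keeps the square root below `ε / 2`, so the entries of the noise
term must account for the other half, which `h2` makes unlikely. -/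
theorem measureReal_lt_lambdaHat_le (h : IsModel f x P Z θ C σ) (hp : 0 < p) (hn : 0 < n)
    (hC : 0 < C) (hσ : 0 < σ) {ε : ℝ} (hε : 0 < ε)
    (h1 : 2 * C * (σ : ℝ) ^ 2 / (ε / 2) ^ 2 ≤ n)
    (h2 : (p : ℝ) ^ 4 * C ^ 2 * σ ^ 2 / ((ε / 2) ^ 2 * ε) ≤ n) :
    P.real {ω | ε < lambdaHat f x C σ θ (responses f x θ Z ω)} ≤ ε := by
  have hn' : (0 : ℝ) < n := by exact_mod_cast hn
  set X : Ω → Matrix (Fin p) (Fin p) ℝ := fun ω => noiseHessian f x (responses f x θ Z ω) θ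
    with hX
  set S : Ω → ℝ := fun ω => ∑ i, ∑ j, X ω i j ^ 2 with hS
  have hint : ∀ i j, Integrable (fun ω => X ω i j ^ 2) P := fun i j => by
    simp only [hX, noiseHessian_responses_apply]
    exact (memLp_sum_mul_noise h.law _).integrable_sq
  have hSint : Integrable S P :=
    integrable_finsetSum _ fun i _ => integrable_finsetSum _ fun j _ => hint i j
  have hmean : ∫ ω, S ω ∂P ≤ (p : ℝ) ^ 2 * (C ^ 2 * σ ^ 2 / n) := by
    rw [integral_finsetSum _ fun i _ => integrable_finsetSum _ fun j _ => hint i j]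
    simp only [integral_finsetSum _ fun j _ => hint _ j]
    refine (Finset.sum_le_sum fun i _ => Finset.sum_le_sum fun j _ =>
      h.integral_noiseHessian_sq_le hn i j).trans_eq ?_
    simp
    ring
  -- Cauchy–Schwarz over the `p²` entries; the mean of `S` contributes another `p²`, whence `p⁴` in
  -- `h2`.
  have hcs : ∀ ω, (∑ i, ∑ j, |X ω i j|) ^ 2 ≤ (p : ℝ) ^ 2 * S ω := fun ω => by
    have := sq_sum_le_card_mul_sum_sq (s := (Finset.univ : Finset (Fin p × Fin p)))
      (f := fun q => |X ω q.1 q.2|)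
    simpa [Fintype.sum_prod_type, sq_abs, hS, pow_two (p : ℝ)] using this
  have hsub : {ω | ε < lambdaHat f x C σ θ (responses f x θ Z ω)}
      ⊆ {ω | (ε / 2) ^ 2 ≤ (p : ℝ) ^ 2 * S ω} := fun ω hω => by
    have hω' : ε < lambdaHat f x C σ θ (responses f x θ Z ω) := hω
    have h3 := lambdaHat_le (C := C) (σ := σ) hp h.twiceDiff (responses f x θ Z ω)
    have h4 := sqrt_lambdaHat_le hp hn hC (NNReal.coe_pos.2 hσ) (half_pos hε) h1
    have h5 : ε / 2 ≤ ∑ i, ∑ j, |X ω i j| := by linarith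
    exact (pow_le_pow_left₀ (half_pos hε).le h5 2).trans (hcs ω)
  have hmarkov := mul_meas_ge_le_integral_of_nonneg (μ := P)
    (f := fun ω => (p : ℝ) ^ 2 * S ω) (.of_forall fun ω => by positivity)
    (hSint.const_mul _) ((ε / 2) ^ 2)
  rw [integral_const_mul] at hmarkov
  refine (measureReal_mono hsub).trans ?_
  have hε2 : (0 : ℝ) < (ε / 2) ^ 2 := by positivity
  have h6 : (p : ℝ) ^ 2 * ∫ ω, S ω ∂P ≤ (ε / 2) ^ 2 * ε := by
    calc (p : ℝ) ^ 2 * ∫ ω, S ω ∂P ≤ (p : ℝ) ^ 2 * ((p : ℝ) ^ 2 * (C ^ 2 * σ ^ 2 / n)) := by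
          gcongr
      _ = (p : ℝ) ^ 4 * C ^ 2 * σ ^ 2 / n := by ring
      _ ≤ (ε / 2) ^ 2 * ε := by
          rw [div_le_iff₀ (by positivity)] at h2 ⊢
          linarith
  exact le_of_mul_le_mul_left (hmarkov.trans h6) hε2

end IsModel

end NonlinearLS

theorem mainTheorem5 {d p : ℕ} (hp : 0 < p) (C : ℝ) (hC : 0 < C) (σ : ℝ≥0) (hσ : 0 < σ) :
    -- the bound for every sample size
    (∀ (n : ℕ), 0 < n →
      ∀ (f : NonlinearLS.Vec d → NonlinearLS.Vec p → ℝ) (θs : NonlinearLS.Vec p)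
        (x : Fin n → NonlinearLS.Vec d)
        (Ω : Type*) [MeasurableSpace Ω] (P : Measure Ω) [IsProbabilityMeasure P]
        (Z : Fin n → Ω → ℝ), NonlinearLS.IsModel f x P Z θs C σ →
      (∀ ω, 0 < NonlinearLS.lambdaHat f x C σ θs (NonlinearLS.responses f x θs Z ω)) ∧
      (∀ ω, (NonlinearLS.regHessian f x (NonlinearLS.responses f x θs Z ω)
        (NonlinearLS.lambdaHat f x C σ θs (NonlinearLS.responses f x θs Z ω)) θs).PosDef) ∧
      NonlinearLS.MatrixIntegrable P
        (fun ω => NonlinearLS.tunedWeight f x C σ θs (NonlinearLS.responses f x θs Z ω)) ∧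
      NonlinearLS.LoewnerLE
        (NonlinearLS.matrixMean P
          (fun ω => NonlinearLS.tunedWeight f x C σ θs (NonlinearLS.responses f x θs Z ω)))
        ((NonlinearLS.fisherInfo f x P (NonlinearLS.responses f x θs Z) θs)⁻¹
          + ((σ : ℝ) ^ 2 / n) • (1 : Matrix (Fin p) (Fin p) ℝ))) ∧
    -- the asymptotic bound, with a regularization that tends to zero in probability
    (∀ ε : ℝ, 0 < ε → ∃ N : ℕ, ∀ n : ℕ, N ≤ n →
      ∀ (f : NonlinearLS.Vec d → NonlinearLS.Vec p → ℝ) (θs : NonlinearLS.Vec p)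
        (x : Fin n → NonlinearLS.Vec d)
        (Ω : Type*) [MeasurableSpace Ω] (P : Measure Ω) [IsProbabilityMeasure P]
        (Z : Fin n → Ω → ℝ), NonlinearLS.IsModel f x P Z θs C σ →
      NonlinearLS.LoewnerLE
        (NonlinearLS.matrixMean P
          (fun ω => NonlinearLS.tunedWeight f x C σ θs (NonlinearLS.responses f x θs Z ω)))
        ((NonlinearLS.fisherInfo f x P (NonlinearLS.responses f x θs Z) θs)⁻¹
          + ε • (1 : Matrix (Fin p) (Fin p) ℝ)) ∧
      P.real {ω | ε < NonlinearLS.lambdaHat f x C σ θs (NonlinearLS.responses f x θs Z ω)}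
        ≤ ε) := by
  refine ⟨fun n hn f θs x Ω _ P _ Z h => ⟨fun ω => NonlinearLS.lambdaHat_pos hp hn hC _,
    fun ω => NonlinearLS.posDef_regHessian_lambdaHat hp hn hC h.twiceDiff _,
    h.matrixIntegrable_tunedWeight hp hn hC,
    h.matrixMean_tunedWeight_le hp hn hC (by positivity)⟩, fun ε hε => ?_⟩
  -- The `1` forces `n > 0`; the other two are the thresholds for the square root and for Markov's
  -- inequality.
  obtain ⟨N, hN⟩ := exists_nat_ge (max 1 (max (2 * C * (σ : ℝ) ^ 2 / (ε / 2) ^ 2)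
    ((p : ℝ) ^ 4 * C ^ 2 * σ ^ 2 / ((ε / 2) ^ 2 * ε))))
  refine ⟨N, fun n hNn f θs x Ω _ P _ Z h => ?_⟩
  have hn := hN.trans (Nat.cast_le.2 hNn)
  rw [max_le_iff, max_le_iff] at hn
  have hn0 : 0 < n := by exact_mod_cast zero_lt_one.trans_le hn.1
  exact ⟨h.matrixMean_tunedWeight_le hp hn0 hC hε.le,
    h.measureReal_lt_lambdaHat_le hp hn0 hC hσ hε hn.2.1 hn.2.2⟩
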